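/- Let $N\ge 1$, let $\Omega\subset\mathbb R^N$ be a bounded open set of class $C^2$, and let $A\ge a>0$, $\alpha>-1$, $0<\beta\le\alpha+2$. For a symmetric matrix $X$ with eigenvalues $\lambda_1,\dots,\lambda_N$ set $$\mathcal M^+(X)=A\sum_{\lambda_i>0}\lambda_i+a\sum_{\lambda_i<0}\lambda_i,\qquad \mathcal M^-(X)=a\sum_{\lambda_i>0}\lambda_i+A\sum_{\lambda_i<0}\lambda_i .$$ Let $F$ be a function of $p\in\mathbb R^N\setminus\{0\}$ and a symmetric matrix $X$, let $b$ be a function on $\Omega$ and let $f$ be a function on $\Omega\times\mathbb R$. A lower (upper) semicontinuous function $u$ is called a viscosity supersolution (subsolution) in $\Omega$ of $-F(\nabla u,D^2u)+b(x)|\nabla u|^\beta=f(x,u)$ if for every $x_0\in\Omega$: when $u$ is constant near $x_0$, $f(x_0,u(x_0))\le 0$ (respectively $\ge 0$); when $u$ is not constant near $x_0$, every $\phi$ of class $C^2$ near $x_0$ such that $u-\phi$ has a local minimum (maximum) at $x_0$ and $\nabla\phi(x_0)\ne0$ satisfies $$-F(\nabla\phi(x_0),D^2\phi(x_0))+b(x_0)|\nabla\phi(x_0)|^\beta\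 \ge\ (\le)\ f(x_0,u(x_0)).$$ Let $\lambda>0$ and let $b>0$ be a constant. Then for every $M>0$: (i) there is a continuous function $\varphi\ge0$ on $\overline\Omega$ with $\varphi=0$ on $\partial\Omega$ that is a viscosity supersolution in $\Omega$, in the above sense, of $$-|\nabla\varphi|^\alpha\mathcal M^+(D^2\varphi)-b|\nabla\varphi|^\beta+\lambda\varphi^{1+\alpha}\ge M;$$ (ii) there is a continuous function $\varphi\le0$ on $\overline\Omega$ with $\varphi=0$ on $\partial\Omega$ that is a viscosity subsolution in $\Omega$, in the above sense, of $$-|\nabla\varphi|^\alpha\mathcal M^-(D^2\varphi)+b|\nabla\varphi|^\beta+\lambda|\varphi|^\alpha\varphi\le -M.$$ Moreover, with $d(x)=\operatorname{dist}(x,\partial\Omega)$, the function $\varphi$ in (i) can be taken of the form $$\varphi(x)=c\,\min\{\log(1+C\,d(x)),\ \log(1+\kappa)\}$$ for some constants $c,C,\kappa>0$, with $c=1$ if $\beta<\alpha+2$, and $\varphi$ in (ii) can be taken to be the negative of a function of this form. -/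

import Mathlib

open Set Filter Topology

noncomputable section

namespace PucciBarrier

/-- `ℝ^N` with the Euclidean norm. -/
abbrev E (N : ℕ) : Type := EuclideanSpace ℝ (Fin N)

/-- The real symmetric `N × N` matrices (over `ℝ`, Hermitian means symmetric). -/
abbrev Sym (N : ℕ) : Type := {X : Matrix (Fin N) (Fin N) ℝ // X.IsHermitian}

/-- `Ω` is an open set of class `C²`: near each boundary point it is the set where a `C²` function
with nonvanishing differential is negative. -/
def IsC2Open {N : ℕ} (Ω : Set (E N)) : Prop :=
  IsOpen Ω ∧ ∀ x₀ ∈ frontier Ω, ∃ (U : Set (E N)) (ρ : E N → ℝ),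
    IsOpen U ∧ x₀ ∈ U ∧ ContDiffOn ℝ 2 ρ U ∧ (∀ x ∈ U, fderiv ℝ ρ x ≠ 0) ∧
      Ω ∩ U = {x ∈ U | ρ x < 0}

/-- The Pucci operator `A ∑_{λ_i > 0} λ_i + a ∑_{λ_i < 0} λ_i`, the `λ_i` being the eigenvalues
of `X` counted with multiplicity. -/
def pucciPlus {N : ℕ} (a A : ℝ) (X : Sym N) : ℝ :=
  A * (∑ i with 0 < X.2.eigenvalues i, X.2.eigenvalues i) +
    a * (∑ i with X.2.eigenvalues i < 0, X.2.eigenvalues i)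

/-- The Pucci operator `a ∑_{λ_i > 0} λ_i + A ∑_{λ_i < 0} λ_i`. -/
def pucciMinus {N : ℕ} (a A : ℝ) (X : Sym N) : ℝ :=
  a * (∑ i with 0 < X.2.eigenvalues i, X.2.eigenvalues i) +
    A * (∑ i with X.2.eigenvalues i < 0, X.2.eigenvalues i)

/-- The matrix of second partial derivatives. -/
def hessianMatrix {N : ℕ} (φ : E N → ℝ) (x : E N) : Matrix (Fin N) (Fin N) ℝ :=
  Matrix.of fun i j =>
    fderiv ℝ (fderiv ℝ φ) x (EuclideanSpace.single i 1) (EuclideanSpace.single j 1)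

theorem hessianMatrix_isHermitian {N : ℕ} {φ : E N → ℝ} {x : E N} (h : ContDiffAt ℝ 2 φ x) :
    (hessianMatrix φ x).IsHermitian := by
  ext i j
  have hs : IsSymmSndFDerivAt ℝ φ x := h.isSymmSndFDerivAt (by simp)
  simp only [Matrix.conjTranspose_apply, hessianMatrix, Matrix.of_apply, star_trivial]
  exact hs.eq _ _

/-- The Hessian `D²φ(x)` of a function that is `C²` around `x`. -/
def hessian {N : ℕ} (φ : E N → ℝ) (x : E N) (h : ContDiffAt ℝ 2 φ x) : Sym N :=
  ⟨hessianMatrix φ x, hessianMatrix_isHermitian h⟩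

/-- `u` is constant in a neighbourhood of `x`. -/
def LocallyConstantAt {N : ℕ} (u : E N → ℝ) (x : E N) : Prop :=
  ∀ᶠ y in 𝓝 x, u y = u x

/-- `u` is a viscosity supersolution in `Ω` of `-F(∇u, D²u) + b(x) |∇u|^β = f(x, u)`.
At points where `u` is locally constant the equation is evaluated with vanishing derivatives; at all
other points only test functions with nonvanishing gradient are used. -/
def IsViscositySupersolution {N : ℕ} (F : E N → Sym N → ℝ) (b : E N → ℝ) (β : ℝ)
    (f : E N → ℝ → ℝ) (Ω : Set (E N)) (u : E N → ℝ) : Prop :=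
  LowerSemicontinuousOn u Ω ∧ ∀ x₀ ∈ Ω,
    (LocallyConstantAt u x₀ → f x₀ (u x₀) ≤ 0) ∧
    (¬ LocallyConstantAt u x₀ → ∀ (φ : E N → ℝ) (hφ : ContDiffAt ℝ 2 φ x₀),
      IsLocalMin (fun x => u x - φ x) x₀ → gradient φ x₀ ≠ 0 →
        f x₀ (u x₀) ≤
          -F (gradient φ x₀) (hessian φ x₀ hφ) + b x₀ * ‖gradient φ x₀‖ ^ β)

/-- `u` is a viscosity subsolution in `Ω` of `-F(∇u, D²u) + b(x) |∇u|^β = f(x, u)`. -/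
def IsViscositySubsolution {N : ℕ} (F : E N → Sym N → ℝ) (b : E N → ℝ) (β : ℝ)
    (f : E N → ℝ → ℝ) (Ω : Set (E N)) (u : E N → ℝ) : Prop :=
  UpperSemicontinuousOn u Ω ∧ ∀ x₀ ∈ Ω,
    (LocallyConstantAt u x₀ → 0 ≤ f x₀ (u x₀)) ∧
    (¬ LocallyConstantAt u x₀ → ∀ (φ : E N → ℝ) (hφ : ContDiffAt ℝ 2 φ x₀),
      IsLocalMax (fun x => u x - φ x) x₀ → gradient φ x₀ ≠ 0 →
        -F (gradient φ x₀) (hessian φ x₀ hφ) + b x₀ * ‖gradient φ x₀‖ ^ β ≤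
          f x₀ (u x₀))

/-- The function `c · log(1 + C d(x))` truncated at the level `c · log(1 + κ)`, where
`d(x)` is the distance from `x` to the boundary of `Ω`. -/
def truncatedLog {N : ℕ} (Ω : Set (E N)) (c C κ : ℝ) (x : E N) : ℝ :=
  c * min (Real.log (1 + C * Metric.infDist x (frontier Ω))) (Real.log (1 + κ))

end PucciBarrier

end

/-! A C² boundary is touched from outside by balls of one radius R. If y is a boundary point nearest
to x, the distance d lies below the distance to the exterior ball at y. Hence d(x+h) ≤ d(x) + ⟨n,h⟩
+ |h|²/(2R) with n a unit vector (`exists_infDist_frontier_le`). This holds on all of Ω, so no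
smoothness of d is needed.

Composing with c·log(1+C·), put g = C/(1+C d). A test function touching from below has gradient c g
n, and its Hessian is at most (c g/R) I - c g² n⊗n. By `pucciPlus_le` the operator is at most (cg)^α
(A N c g/R - a c g²). The term of order g^(α+2) beats the curvature term of order g^(α+1). It also
beats b(cg)^β, where c must be small if β = α+2. Large g therefore gives any M
(`exists_barrier_constants`).

The truncation level makes the zero-order term equal to M on the plateau. Every test function from
below at a plateau point has zero gradient, so the edge of the plateau imposes nothing. Below the
plateau g ≥ C/(1+κ), which is made large through C.

`exists_truncatedLog_barrier` records only directional second derivatives, so it serves (i) directly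
and (ii) after a change of sign. -/

noncomputable section

namespace PucciBarrier

open scoped RealInnerProductSpace

/-! ### Uniform exterior balls for C² domains -/

/-- A ball around a point of `Ω` whose radius is the distance to the boundary lies in `Ω`. -/
theorem ball_infDist_frontier_subset {N : ℕ} {Ω : Set (E N)} (hΩ : IsOpen Ω) {x : E N}
    (hx : x ∈ Ω) : Metric.ball x (Metric.infDist x (frontier Ω)) ⊆ Ω := by
  rcases le_or_gt (Metric.infDist x (frontier Ω)) 0 with h0 | h0
  · rw [Metric.ball_eq_empty.2 h0]
    exact empty_subset _
  have hdis := Metric.disjoint_ball_infDist (s := frontier Ω) (x := x)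
  -- The ball is connected and misses the frontier, so it cannot meet both Ω and the complement of
  -- its closure.
  refine IsPreconnected.subset_left_of_subset_union hΩ (isClosed_closure (s := Ω)).isOpen_compl
    ?_ ?_ ⟨x, Metric.mem_ball_self h0, hx⟩ (convex_ball x _).isPreconnected
  · exact Set.disjoint_left.2 fun y hy hy' => hy' (subset_closure hy)
  · intro y hy
    by_cases hyΩ : y ∈ Ω
    · exact Or.inl hyΩ
    · refine Or.inr fun hyc => Set.disjoint_left.1 hdis hy ?_
      rw [hΩ.frontier_eq]
      exact ⟨hyc, hyΩ⟩

theorem frontier_nonempty_of_isBounded {N : ℕ} (hN : 1 ≤ N) {Ω : Set (E N)}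
    (hb : Bornology.IsBounded Ω) (hne : Ω.Nonempty) : (frontier Ω).Nonempty := by
  have : Nonempty (Fin N) := ⟨⟨0, hN⟩⟩
  refine nonempty_frontier_iff.2 ⟨hne, fun h => ?_⟩
  rw [h] at hb
  exact NormedSpace.unbounded_univ ℝ (E N) hb

/-- A vector making a nonpositive inner product with an open half space is opposite to its
normal. -/
theorem eq_neg_norm_smul_of_inner_nonpos {N : ℕ} {g n : E N} (hn : ‖n‖ = 1)
    (h : ∀ v : E N, 0 < ⟪n, v⟫ → ⟪g, v⟫ ≤ 0) : g = -(‖g‖ • n) := by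
  by_contra hne
  -- The vector v = g + |g| n is the violating direction: if v ≠ 0, both ⟨n,v⟩ and ⟨g,v⟩ are
  -- positive.
  have hsq : ‖g + ‖g‖ • n‖ ^ 2 = 2 * ‖g‖ * (⟪n, g⟫ + ‖g‖) := by
    rw [norm_add_sq_real, norm_smul, hn, inner_smul_right, real_inner_comm]
    simp only [norm_norm, mul_one]
    ring
  have hpos : 0 < ‖g + ‖g‖ • n‖ ^ 2 := by
    have : g + ‖g‖ • n ≠ 0 := fun h0 => hne (eq_neg_of_add_eq_zero_left h0)
    positivity
  have hg : 0 ≤ ‖g‖ := norm_nonneg g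
  have h1 : 0 < ⟪n, g + ‖g‖ • n⟫ := by
    rw [inner_add_right, inner_smul_right, real_inner_self_eq_norm_sq, hn]
    nlinarith
  have h2 := h _ h1
  rw [inner_add_right, inner_smul_right, real_inner_self_eq_norm_sq, real_inner_comm] at h2
  nlinarith

/-- The defining function of a `C²` open set vanishes on the boundary. -/
theorem definingFunction_eq_zero {N : ℕ} {Ω U : Set (E N)} {ρ : E N → ℝ} (hΩ : IsOpen Ω)
    (hU : IsOpen U) (hρ : ContinuousOn ρ U) (hΩU : Ω ∩ U = {x ∈ U | ρ x < 0}) {y : E N}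
    (hy : y ∈ frontier Ω) (hyU : y ∈ U) : ρ y = 0 := by
  rw [hΩ.frontier_eq] at hy
  have hcont : ContinuousAt ρ y := hρ.continuousAt (hU.mem_nhds hyU)
  refine le_antisymm ?_ ?_
  · by_contra hlt
    have h1 : ∀ᶠ x in 𝓝 y, 0 < ρ x := hcont.eventually (lt_mem_nhds (not_le.1 hlt))
    obtain ⟨x, hxΩ, hx1, hx2⟩ := ((mem_closure_iff_frequently.1 hy.1).and_eventually
      (h1.and (hU.mem_nhds hyU))).exists
    have : x ∈ {x ∈ U | ρ x < 0} := hΩU ▸ ⟨hxΩ, hx2⟩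
    exact absurd this.2 (not_lt.2 hx1.le)
  · by_contra hlt
    have : y ∈ Ω ∩ U := by
      rw [hΩU]
      exact ⟨hyU, not_le.1 hlt⟩
    exact hy.2 this.1

/-- At a boundary point touched by an interior ball, the gradient of the defining function is
normal to the ball. -/
theorem gradient_definingFunction {N : ℕ} {Ω U : Set (E N)} {ρ : E N → ℝ}
    (hU : IsOpen U) (hΩU : Ω ∩ U = {x ∈ U | ρ x < 0}) {y n : E N}
    (hyU : y ∈ U) (hd : DifferentiableAt ℝ ρ y) (hρy : ρ y = 0) (hn : ‖n‖ = 1) {r : ℝ}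
    (hr : 0 < r) (hball : Metric.ball (y + r • n) r ⊆ Ω) :
    gradient ρ y = -(‖gradient ρ y‖ • n) := by
  refine eq_neg_norm_smul_of_inner_nonpos hn fun v hv => ?_
  have hg : HasDerivAt (fun t : ℝ => ρ (y + t • v)) ⟪gradient ρ y, v⟫ 0 := by
    have h1 : HasFDerivAt ρ (fderiv ℝ ρ y) (y + (0 : ℝ) • v) := by simpa using hd.hasFDerivAt
    have h2 : HasDerivAt (fun t : ℝ => y + t • v) v 0 := by
      simpa using ((hasDerivAt_id (0 : ℝ)).smul_const v).const_add y
    have := h1.comp_hasDerivAt (0 : ℝ) h2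
    rwa [gradient, InnerProductSpace.toDual_symm_apply]
  have hU' : ∀ᶠ t : ℝ in 𝓝[>] 0, y + t • v ∈ U := by
    have : ContinuousAt (fun t : ℝ => y + t • v) 0 := by fun_prop
    exact (this.eventually (by simpa using hU.mem_nhds hyU)).filter_mono nhdsWithin_le_nhds
  -- This is exactly the condition |t v - r n| < r, divided by t: the ray enters the interior ball.
  have hsmall : ∀ᶠ t : ℝ in 𝓝[>] 0, t * ‖v‖ ^ 2 < 2 * r * ⟪n, v⟫ := by
    have : ContinuousAt (fun t : ℝ => t * ‖v‖ ^ 2) 0 := by fun_prop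
    refine (this.eventually (gt_mem_nhds ?_)).filter_mono nhdsWithin_le_nhds
    simp only [zero_mul]
    positivity
  have hneg : ∀ᶠ t : ℝ in 𝓝[>] 0, slope (fun t : ℝ => ρ (y + t • v)) 0 t ≤ 0 := by
    filter_upwards [hU', hsmall, self_mem_nhdsWithin] with t ht1 ht2 ht3
    have ht3 : 0 < t := ht3
    have hin : y + t • v ∈ Ω := by
      refine hball ?_
      rw [mem_ball_iff_norm]
      have he : y + t • v - (y + r • n) = t • v - r • n := by abel
      rw [he]
      refine lt_of_pow_lt_pow_left₀ 2 hr.le ?_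
      rw [norm_sub_sq_real, norm_smul, norm_smul, inner_smul_left, inner_smul_right, hn,
        real_inner_comm]
      simp only [Real.norm_eq_abs, mul_pow, sq_abs, conj_trivial, mul_one]
      nlinarith
    have : y + t • v ∈ {x ∈ U | ρ x < 0} := hΩU ▸ ⟨hin, ht1⟩
    have h3 : ρ (y + t • v) < 0 := this.2
    rw [slope_def_field]
    simp only [zero_smul, add_zero, sub_zero, hρy]
    exact div_nonpos_of_nonpos_of_nonneg h3.le ht3.le
  have hlim := (hasDerivAt_iff_tendsto_slope.1 hg).mono_left
    (nhdsWithin_mono (0 : ℝ) (s := Ioi 0) (fun t ht => ne_of_gt ht))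
  exact le_of_tendsto hlim hneg

/-- Second order Taylor bound, uniform near a point. -/
theorem exists_taylor_bound {N : ℕ} {ρ : E N → ℝ} {y : E N} (h : ContDiffAt ℝ 2 ρ y) :
    ∃ K r : ℝ, 0 < K ∧ 0 < r ∧ ∀ x ∈ Metric.ball y r, ∀ z ∈ Metric.ball y r,
      |ρ z - ρ x - fderiv ℝ ρ x (z - x)| ≤ K * ‖z - x‖ ^ 2 := by
  obtain ⟨K, t, ht, hL⟩ := (h.fderiv_right (m := 1) (by norm_num)).exists_lipschitzOnWith
  have hdiff : ∀ᶠ x in 𝓝 y, DifferentiableAt ℝ ρ x :=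
    (h.eventually (by simp)).mono fun x hx => hx.differentiableAt (by simp)
  obtain ⟨r, hr, hball⟩ := Metric.mem_nhds_iff.1 (inter_mem ht hdiff)
  refine ⟨K + 1, r, by positivity, hr, fun x hx z hz => ?_⟩
  -- Intersecting with the closed ball of radius |z - x| bounds the variation of the derivative by
  -- K|z - x|, which makes the error quadratic.
  have hconv : Convex ℝ (Metric.ball y r ∩ Metric.closedBall x ‖z - x‖) :=
    (convex_ball _ _).inter (convex_closedBall _ _)
  have := hconv.norm_image_sub_le_of_norm_fderiv_le' (𝕜 := ℝ) (f := ρ) (φ := fderiv ℝ ρ x)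
    (C := K * ‖z - x‖) (x := x) (y := z) (fun w hw => (hball hw.1).2) ?_
    ⟨hx, by simp⟩ ⟨hz, by simp [dist_eq_norm]⟩
  · rw [Real.norm_eq_abs] at this
    nlinarith [sq_nonneg ‖z - x‖]
  · intro w hw
    rw [← dist_eq_norm]
    refine (hL.dist_le_mul w (hball hw.1).1 x (hball hx).1).trans ?_
    exact mul_le_mul_of_nonneg_left hw.2 K.2

/-- The exterior ball property of radius `R` at the point `y`, for every direction of an interior
touching ball. -/
def HasExteriorBall {N : ℕ} (Ω : Set (E N)) (R : ℝ) (y : E N) : Prop :=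
  ∀ (n : E N) (r : ℝ), ‖n‖ = 1 → 0 < r → Metric.ball (y + r • n) r ⊆ Ω →
    Disjoint Ω (Metric.ball (y - R • n) R)

/-- For y + h in the exterior ball, |h|² < -2R⟨n,h⟩. Taylor's formula then gives ρ(y+h) ≥ (m -
2KR)(-⟨n,h⟩) ≥ 0, so y + h is not in Ω. Allowing every R ≤ R₀ lets finitely many neighbourhoods
share one radius. -/
theorem exists_hasExteriorBall_nhds {N : ℕ} {Ω : Set (E N)} (hΩ : IsC2Open Ω) {y₀ : E N}
    (hy₀ : y₀ ∈ frontier Ω) :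
    ∃ t ∈ 𝓝[frontier Ω] y₀, ∃ R₀ > 0, ∀ R, 0 < R → R ≤ R₀ → ∀ y ∈ t, HasExteriorBall Ω R y := by
  obtain ⟨hΩo, hloc⟩ := hΩ
  obtain ⟨U, ρ, hU, hyU, hρ, hρ0, hΩU⟩ := hloc y₀ hy₀
  have hC2 : ContDiffAt ℝ 2 ρ y₀ := hρ.contDiffAt (hU.mem_nhds hyU)
  obtain ⟨K, r₁, hK, hr₁, hT⟩ := exists_taylor_bound hC2
  have hcont : ContinuousAt (fun y => ‖gradient ρ y‖) y₀ := by
    have h1 : ContinuousAt (fderiv ℝ ρ) y₀ :=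
      (hC2.fderiv_right (m := 1) (by norm_num)).continuousAt
    exact ((InnerProductSpace.toDual ℝ (E N)).symm.continuous.continuousAt.comp h1).norm
  have hgpos : 0 < ‖gradient ρ y₀‖ := by
    rw [norm_pos_iff, gradient, Ne, LinearIsometryEquiv.map_eq_zero_iff]
    exact hρ0 _ hyU
  set m := ‖gradient ρ y₀‖ / 2 with hm
  have hmpos : 0 < m := by positivity
  have hgm : ∀ᶠ y in 𝓝 y₀, m < ‖gradient ρ y‖ :=
    hcont.eventually (lt_mem_nhds (by rw [hm]; linarith))
  obtain ⟨r₂, hr₂, hball⟩ := Metric.mem_nhds_iff.1 (inter_mem hgm (hU.mem_nhds hyU))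
  set r := min r₁ r₂ with hrdef
  have hr : 0 < r := lt_min hr₁ hr₂
  refine ⟨Metric.ball y₀ (r / 2) ∩ frontier Ω,
    inter_mem (mem_nhdsWithin_of_mem_nhds (Metric.ball_mem_nhds _ (by positivity)))
      -- The bound r/4 keeps y + h, with |h| < 2R, in the ball where Taylor's bound holds; m/(2K)
      -- lets the linear term absorb the quadratic one.
      self_mem_nhdsWithin, min (r / 4) (m / (2 * K)), by positivity, ?_⟩
  rintro R hR hRle y ⟨hy, hyF⟩ n s hn hs hsball
  have hRr : R ≤ r / 4 := hRle.trans (min_le_left _ _)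
  have hRm : 2 * K * R ≤ m := by
    have := hRle.trans (min_le_right _ _)
    rw [le_div_iff₀ (by positivity)] at this
    linarith
  rw [Metric.mem_ball] at hy
  have hy2 : y ∈ Metric.ball y₀ r₂ := by
    rw [Metric.mem_ball]; linarith [min_le_right r₁ r₂]
  have hyU' : y ∈ U := (hball hy2).2
  have hyd : DifferentiableAt ℝ ρ y :=
    (hρ.contDiffAt (hU.mem_nhds hyU')).differentiableAt (by simp)
  have hρy := definingFunction_eq_zero hΩo hU hρ.continuousOn hΩU hyF hyU'
  have hgrad := gradient_definingFunction hU hΩU hyU' hyd hρy hn hs hsball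
  have hgy : m < ‖gradient ρ y‖ := (hball hy2).1
  refine Set.disjoint_left.2 fun z hzΩ hz => ?_
  rw [mem_ball_iff_norm] at hz
  obtain ⟨h, rfl⟩ : ∃ h, z = y + h := ⟨z - y, by abel⟩
  have he : y + h - (y - R • n) = h + R • n := by abel
  rw [he] at hz
  have hlen : ‖h‖ < 2 * R := by
    have h1 : ‖h‖ ≤ ‖h + R • n‖ + ‖R • n‖ := by
      simpa using norm_sub_le (h + R • n) (R • n)
    rw [norm_smul, hn, Real.norm_eq_abs, abs_of_pos hR] at h1
    linarith
  have hin : ‖h‖ ^ 2 + 2 * R * ⟪n, h⟫ < 0 := by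
    have h1 : ‖h + R • n‖ ^ 2 < R ^ 2 := pow_lt_pow_left₀ hz (norm_nonneg _) two_ne_zero
    rw [norm_add_sq_real, norm_smul, hn, inner_smul_right, real_inner_comm] at h1
    simp only [Real.norm_eq_abs, sq_abs, mul_one] at h1
    linarith
  have hdz : dist (y + h) y₀ < r := by
    calc dist (y + h) y₀ ≤ dist (y + h) y + dist y y₀ := dist_triangle _ _ _
      _ < 2 * R + r / 2 := by
        rw [dist_eq_norm, add_sub_cancel_left]
        linarith
      _ ≤ r := by linarith
  have hz2 : y + h ∈ Metric.ball y₀ r₂ := by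
    rw [Metric.mem_ball]; linarith [min_le_right r₁ r₂]
  have hneg : ρ (y + h) < 0 := by
    have : y + h ∈ {x ∈ U | ρ x < 0} := hΩU ▸ ⟨hzΩ, (hball hz2).2⟩
    exact this.2
  have hTay := hT y (by rw [Metric.mem_ball]; linarith [min_le_left r₁ r₂]) (y + h)
    (by rw [Metric.mem_ball]; linarith [min_le_left r₁ r₂])
  rw [add_sub_cancel_left, hρy] at hTay
  have hfd : fderiv ℝ ρ y h = -(‖gradient ρ y‖ * ⟪n, h⟫) := by
    have h1 : fderiv ℝ ρ y h = ⟪gradient ρ y, h⟫ := by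
      rw [gradient, InnerProductSpace.toDual_symm_apply]
    rw [h1]
    conv_lhs => rw [hgrad]
    rw [inner_neg_left, inner_smul_left]
    simp
  have h1 := (abs_le.1 hTay).1
  rw [hfd] at h1
  have h2 : 0 < -⟪n, h⟫ := by
    by_contra hcon
    have : 0 ≤ 2 * R * ⟪n, h⟫ := by
      have : 0 ≤ ⟪n, h⟫ := by linarith
      positivity
    nlinarith [sq_nonneg ‖h‖]
  have h3 : m * -⟪n, h⟫ ≤ ‖gradient ρ y‖ * -⟪n, h⟫ :=
    mul_le_mul_of_nonneg_right hgy.le h2.le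
  have h4 : 2 * K * R * -⟪n, h⟫ ≤ m * -⟪n, h⟫ := mul_le_mul_of_nonneg_right hRm h2.le
  have h5 : K * ‖h‖ ^ 2 ≤ K * (2 * R * -⟪n, h⟫) := mul_le_mul_of_nonneg_left (by linarith) hK.le
  linarith

/-- A bounded open set of class `C²` satisfies a uniform exterior ball condition. -/
theorem exists_hasExteriorBall {N : ℕ} {Ω : Set (E N)} (hΩ : IsC2Open Ω)
    (hb : Bornology.IsBounded Ω) : ∃ R > 0, ∀ y ∈ frontier Ω, HasExteriorBall Ω R y := by
  have hcpt : IsCompact (frontier Ω) :=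
    Metric.isCompact_of_isClosed_isBounded isClosed_frontier
      (hb.closure.subset frontier_subset_closure)
  obtain ⟨R₀, hR₀, h⟩ := hcpt.induction_on
    (p := fun t => ∃ R₀ > 0, ∀ R, 0 < R → R ≤ R₀ → ∀ y ∈ t, HasExteriorBall Ω R y)
    ⟨1, one_pos, by simp⟩
    (fun s t hst ⟨R₀, hR₀, h⟩ => ⟨R₀, hR₀, fun R hR hle y hy => h R hR hle y (hst hy)⟩)
    (fun s t ⟨R₁, hR₁, h₁⟩ ⟨R₂, hR₂, h₂⟩ => ⟨min R₁ R₂, lt_min hR₁ hR₂, fun R hR hle y hy =>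
      hy.elim (h₁ R hR (hle.trans (min_le_left _ _)) y)
        (h₂ R hR (hle.trans (min_le_right _ _)) y)⟩)
    (fun y hy => exists_hasExteriorBall_nhds hΩ hy)
  exact ⟨R₀, hR₀, h R₀ hR₀ le_rfl⟩

/-! ### Semiconcavity of the distance function -/

/-- The distance to the boundary of a bounded `C²` open set is touched from above, at every point
of the set, by a paraboloid of uniformly bounded opening. -/
theorem exists_infDist_frontier_le {N : ℕ} (hN : 1 ≤ N) {Ω : Set (E N)} (hΩ : IsC2Open Ω)
    (hb : Bornology.IsBounded Ω) : ∃ R > 0, ∀ x ∈ Ω, ∃ n : E N, ‖n‖ = 1 ∧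
      ∀ h : E N, x + h ∈ Ω → Metric.infDist (x + h) (frontier Ω) ≤
        Metric.infDist x (frontier Ω) + ⟪n, h⟫ + ‖h‖ ^ 2 / (2 * R) := by
  obtain ⟨R, hR, hext⟩ := exists_hasExteriorBall hΩ hb
  have hΩo := hΩ.1
  have hcpt : IsCompact (frontier Ω) :=
    Metric.isCompact_of_isClosed_isBounded isClosed_frontier
      (hb.closure.subset frontier_subset_closure)
  refine ⟨R, hR, fun x hx => ?_⟩
  have hne := frontier_nonempty_of_isBounded hN hb ⟨x, hx⟩
  have hpos : ∀ z ∈ Ω, 0 < Metric.infDist z (frontier Ω) := fun z hz =>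
    (isClosed_frontier.notMem_iff_infDist_pos hne).1 fun hzF => by
      rw [hΩo.frontier_eq] at hzF
      exact hzF.2 hz
  obtain ⟨y, hyF, hy⟩ := hcpt.exists_infDist_eq_dist hne x
  have hball := ball_infDist_frontier_subset hΩo hx
  have hd := hpos x hx
  set d := Metric.infDist x (frontier Ω) with hddef
  set n : E N := d⁻¹ • (x - y) with hndef
  have hn : ‖n‖ = 1 := by
    rw [hndef, norm_smul, ← dist_eq_norm, ← hy, norm_inv, Real.norm_eq_abs, abs_of_pos hd]
    exact inv_mul_cancel₀ hd.ne'
  have hxy : y + d • n = x := by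
    rw [hndef, smul_smul, mul_inv_cancel₀ hd.ne', one_smul]
    abel
  have hdis := hext y hyF n d hn hd (by rw [hxy]; exact hball)
  refine ⟨n, hn, fun h hh => ?_⟩
  -- The ball about x + h inside Ω and the exterior ball at y are disjoint, so their radii add up to
  -- at most the distance of the centres.
  have h1 : Metric.infDist (x + h) (frontier Ω) + R ≤ dist (x + h) (y - R • n) :=
    (disjoint_ball_ball_iff (hpos _ hh) hR).1
      (hdis.mono_left (ball_infDist_frontier_subset hΩo hh))
  have he : x + h - (y - R • n) = (d + R) • n + h := by
    rw [← hxy, add_smul]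
    abel
  rw [dist_eq_norm, he] at h1
  have hS : 0 < d + R := by positivity
  have hsq : ‖(d + R) • n + h‖ ^ 2 = (d + R) ^ 2 + 2 * (d + R) * ⟪n, h⟫ + ‖h‖ ^ 2 := by
    rw [norm_add_sq_real, norm_smul, hn, inner_smul_left]
    simp only [Real.norm_eq_abs, sq_abs, conj_trivial, mul_one]
    ring
  -- With S = d + R and w = S n + h, this is 2S|w| ≤ S² + |w|².
  have h2 : ‖(d + R) • n + h‖ ≤ d + R + ⟪n, h⟫ + ‖h‖ ^ 2 / (2 * (d + R)) := by
    have h3 : 2 * (d + R) * (d + R + ⟪n, h⟫ + ‖h‖ ^ 2 / (2 * (d + R))) =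
        (d + R) ^ 2 + ‖(d + R) • n + h‖ ^ 2 := by
      rw [hsq]
      field_simp
      ring
    refine le_of_mul_le_mul_left ?_ (by positivity : 0 < 2 * (d + R))
    rw [h3]
    nlinarith [sq_nonneg (d + R - ‖(d + R) • n + h‖)]
  have h4 : ‖h‖ ^ 2 / (2 * (d + R)) ≤ ‖h‖ ^ 2 / (2 * R) := by
    gcongr
    linarith
  linarith

/-! ### Pucci operators under a rank-one upper bound -/

/-- In an eigenbasis e_i, each eigenvalue contributes at most A s - a t⟨n,e_i⟩², whatever its sign;
the squares ⟨n,e_i⟩² sum to 1. -/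
theorem pucciPlus_le {N : ℕ} {a A s t : ℝ} (ha : 0 < a) (haA : a ≤ A) (hs : 0 ≤ s) (ht : 0 ≤ t)
    (X : Sym N) {n : E N} (hn : ‖n‖ = 1)
    (h : ∀ v : E N, ‖v‖ = 1 → v.ofLp ⬝ᵥ X.1.mulVec v.ofLp ≤ s - t * ⟪n, v⟫ ^ 2) :
    pucciPlus a A X ≤ A * N * s - a * t := by
  have hA : 0 < A := ha.trans_le haA
  have hsum : ∑ i, ⟪n, X.2.eigenvectorBasis i⟫ ^ 2 = 1 := by
    have := X.2.eigenvectorBasis.sum_sq_norm_inner_left n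
    simpa [hn, sq_abs] using this
  have hi : ∀ i, (if 0 < X.2.eigenvalues i then A * X.2.eigenvalues i else 0) +
      (if X.2.eigenvalues i < 0 then a * X.2.eigenvalues i else 0) ≤
      A * s - a * t * ⟪n, X.2.eigenvectorBasis i⟫ ^ 2 := by
    intro i
    have h1 := h (X.2.eigenvectorBasis i) (X.2.eigenvectorBasis.orthonormal.1 i)
    have h2 : X.2.eigenvalues i ≤ s - t * ⟪n, X.2.eigenvectorBasis i⟫ ^ 2 := by
      rw [X.2.eigenvalues_eq i]
      simpa using h1
    have h3 : 0 ≤ t * ⟪n, X.2.eigenvectorBasis i⟫ ^ 2 := by positivity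
    rcases lt_trichotomy (X.2.eigenvalues i) 0 with hl | hl | hl
    · rw [if_neg hl.not_gt, if_pos hl]
      nlinarith
    · rw [if_neg (by linarith), if_neg (by linarith)]
      nlinarith
    · rw [if_pos hl, if_neg hl.not_gt]
      nlinarith
  calc pucciPlus a A X = ∑ i, ((if 0 < X.2.eigenvalues i then A * X.2.eigenvalues i else 0) +
      (if X.2.eigenvalues i < 0 then a * X.2.eigenvalues i else 0)) := by
        rw [pucciPlus, Finset.sum_add_distrib, Finset.mul_sum, Finset.mul_sum,
          Finset.sum_filter, Finset.sum_filter]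
    _ ≤ ∑ i, (A * s - a * t * ⟪n, X.2.eigenvectorBasis i⟫ ^ 2) :=
        Finset.sum_le_sum fun i _ => hi i
    _ = A * N * s - a * t := by
        rw [Finset.sum_sub_distrib, ← Finset.mul_sum _ _ (a * t), hsum]
        simp
        ring

theorem le_pucciMinus {N : ℕ} {a A s t : ℝ} (ha : 0 < a) (haA : a ≤ A) (hs : 0 ≤ s) (ht : 0 ≤ t)
    (X : Sym N) {n : E N} (hn : ‖n‖ = 1)
    (h : ∀ v : E N, ‖v‖ = 1 → -(s - t * ⟪n, v⟫ ^ 2) ≤ v.ofLp ⬝ᵥ X.1.mulVec v.ofLp) :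
    -(A * N * s - a * t) ≤ pucciMinus a A X := by
  have hA : 0 < A := ha.trans_le haA
  have hsum : ∑ i, ⟪n, X.2.eigenvectorBasis i⟫ ^ 2 = 1 := by
    have := X.2.eigenvectorBasis.sum_sq_norm_inner_left n
    simpa [hn, sq_abs] using this
  have hi : ∀ i, -(A * s - a * t * ⟪n, X.2.eigenvectorBasis i⟫ ^ 2) ≤
      (if 0 < X.2.eigenvalues i then a * X.2.eigenvalues i else 0) +
      (if X.2.eigenvalues i < 0 then A * X.2.eigenvalues i else 0) := by
    intro i
    have h1 := h (X.2.eigenvectorBasis i) (X.2.eigenvectorBasis.orthonormal.1 i)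
    have h2 : -(s - t * ⟪n, X.2.eigenvectorBasis i⟫ ^ 2) ≤ X.2.eigenvalues i := by
      rw [X.2.eigenvalues_eq i]
      simpa using h1
    have h3 : 0 ≤ t * ⟪n, X.2.eigenvectorBasis i⟫ ^ 2 := by positivity
    rcases lt_trichotomy (X.2.eigenvalues i) 0 with hl | hl | hl
    · rw [if_neg hl.not_gt, if_pos hl]
      nlinarith
    · rw [if_neg (by linarith), if_neg (by linarith)]
      nlinarith
    · rw [if_pos hl, if_neg hl.not_gt]
      nlinarith
  calc -(A * N * s - a * t) = ∑ i, -(A * s - a * t * ⟪n, X.2.eigenvectorBasis i⟫ ^ 2) := by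
        rw [Finset.sum_neg_distrib, Finset.sum_sub_distrib, ← Finset.mul_sum _ _ (a * t), hsum]
        simp
        ring
    _ ≤ ∑ i, ((if 0 < X.2.eigenvalues i then a * X.2.eigenvalues i else 0) +
      (if X.2.eigenvalues i < 0 then A * X.2.eigenvalues i else 0)) :=
        Finset.sum_le_sum fun i _ => hi i
    _ = pucciMinus a A X := by
        rw [pucciMinus, Finset.sum_add_distrib, Finset.mul_sum, Finset.mul_sum,
          Finset.sum_filter, Finset.sum_filter]

/-! ### Derivatives of test functions -/

theorem dotProduct_hessianMatrix_mulVec {N : ℕ} (φ : E N → ℝ) (x v : E N) :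
    v.ofLp ⬝ᵥ (hessianMatrix φ x).mulVec v.ofLp = fderiv ℝ (fderiv ℝ φ) x v v := by
  have hv : v = ∑ i, v.ofLp i • EuclideanSpace.single i (1 : ℝ) := by
    simpa using ((EuclideanSpace.basisFun (Fin N) ℝ).sum_repr v).symm
  conv_rhs => rw [hv]
  simp only [map_sum, map_smul, _root_.sum_apply, _root_.smul_apply,
    smul_eq_mul, dotProduct, Matrix.mulVec, hessianMatrix, Matrix.of_apply, Finset.mul_sum]
  rw [Finset.sum_comm]
  refine Finset.sum_congr rfl fun i _ => Finset.sum_congr rfl fun j _ => ?_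
  ring

/-- A negative second derivative would make x a local maximum as well, hence f locally constant and
its second derivative zero. -/
theorem second_deriv_nonneg_of_isLocalMin {f f' : ℝ → ℝ} {x f'' : ℝ}
    (hf : ∀ᶠ t in 𝓝 x, HasDerivAt f (f' t) t) (hf' : HasDerivAt f' f'' x) (hmin : IsLocalMin f x) :
    f' x = 0 ∧ 0 ≤ f'' := by
  have h0 : f' x = 0 := hmin.hasDerivAt_eq_zero hf.self_of_nhds
  refine ⟨h0, ?_⟩
  by_contra hneg
  have hd : deriv f =ᶠ[𝓝 x] f' := hf.mono fun t ht => ht.deriv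
  have hdd : deriv (deriv f) x = f'' := by rw [hd.deriv_eq, hf'.deriv]
  have hmax : IsLocalMax f x := isLocalMax_of_deriv_deriv_neg (by rw [hdd]; exact not_le.1 hneg)
    (by rw [hd.self_of_nhds, h0]) hf.self_of_nhds.continuousAt
  have hconst : f =ᶠ[𝓝 x] fun _ => f x := by
    filter_upwards [hmin, hmax] with t h1 h2 using le_antisymm h2 h1
  have hz : deriv f =ᶠ[𝓝 x] fun _ => 0 := by
    filter_upwards [hconst.eventually_nhds] with t ht
    rw [EventuallyEq.deriv_eq ht, deriv_const]
  have : deriv (deriv f) x = 0 := by rw [hz.deriv_eq, deriv_const]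
  linarith

/-- First and second directional derivatives of a `C²` function touched from above along a line. -/
theorem fderiv_eq_and_le_of_touching {N : ℕ} {φ : E N → ℝ} {x v : E N} (hφ : ContDiffAt ℝ 2 φ x)
    {Q Q' : ℝ → ℝ} {Q'' : ℝ} (hQ : ∀ᶠ t in 𝓝 0, HasDerivAt Q (Q' t) t) (hQ' : HasDerivAt Q' Q'' 0)
    (hle : ∀ᶠ t in 𝓝 (0 : ℝ), φ (x + t • v) - φ x ≤ Q t - Q 0) :
    fderiv ℝ φ x v = Q' 0 ∧ fderiv ℝ (fderiv ℝ φ) x v v ≤ Q'' := by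
  have hline : ∀ t : ℝ, HasDerivAt (fun t : ℝ => x + t • v) v t := fun t => by
    simpa using ((hasDerivAt_id t).smul_const v).const_add x
  have hφd : ∀ᶠ t in 𝓝 (0 : ℝ), DifferentiableAt ℝ φ (x + t • v) := by
    have h1 : ∀ᶠ y in 𝓝 x, DifferentiableAt ℝ φ y :=
      (hφ.eventually (by simp)).mono fun y hy => hy.differentiableAt (by simp)
    have h2 : Tendsto (fun t : ℝ => x + t • v) (𝓝 0) (𝓝 x) := by
      simpa using (hline 0).continuousAt.tendsto
    exact h2.eventually h1
  have hφdd : HasFDerivAt (fderiv ℝ φ) (fderiv ℝ (fderiv ℝ φ) x) (x + (0 : ℝ) • v) := by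
    simpa using ((hφ.fderiv_right (m := 1) (by norm_num)).differentiableAt
      (by simp)).hasFDerivAt
  have key := second_deriv_nonneg_of_isLocalMin (f := fun t => Q t - φ (x + t • v))
    (f' := fun t => Q' t - fderiv ℝ φ (x + t • v) v)
    (f'' := Q'' - fderiv ℝ (fderiv ℝ φ) x v v) (x := 0) ?_ ?_ ?_
  · obtain ⟨h1, h2⟩ := key
    simp only [zero_smul, add_zero] at h1
    exact ⟨by linarith, by linarith⟩
  · filter_upwards [hQ, hφd] with t h1 h2
    exact h1.sub (h2.hasFDerivAt.comp_hasDerivAt t (hline t))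
  · refine hQ'.sub ?_
    exact ((ContinuousLinearMap.apply ℝ ℝ v).hasFDerivAt.comp_hasDerivAt (0 : ℝ)
      (hφdd.comp_hasDerivAt (0 : ℝ) (hline 0)))
  · filter_upwards [hle] with t ht
    simp only [zero_smul, add_zero]
    linarith

/-! ### The truncated logarithm of the distance -/

theorem continuous_truncatedLog {N : ℕ} (Ω : Set (E N)) {c C κ : ℝ} (hC : 0 < C) :
    Continuous (truncatedLog Ω c C κ) := by
  have h : Continuous fun x : E N => Real.log (1 + C * Metric.infDist x (frontier Ω)) := by
    refine Continuous.log ?_ fun x => ?_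
    · exact continuous_const.add (continuous_const.mul (Metric.continuous_infDist_pt _))
    · have : 0 ≤ C * Metric.infDist x (frontier Ω) := mul_nonneg hC.le Metric.infDist_nonneg
      linarith
  exact continuous_const.mul (h.min continuous_const)

theorem truncatedLog_nonneg {N : ℕ} (Ω : Set (E N)) {c C κ : ℝ} (hc : 0 < c) (hC : 0 < C)
    (hκ : 0 < κ) (x : E N) : 0 ≤ truncatedLog Ω c C κ x := by
  have : 0 ≤ C * Metric.infDist x (frontier Ω) := mul_nonneg hC.le Metric.infDist_nonneg
  exact mul_nonneg hc.le (le_min (Real.log_nonneg (by linarith)) (Real.log_nonneg (by linarith)))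

theorem truncatedLog_le {N : ℕ} (Ω : Set (E N)) {c C κ : ℝ} (hc : 0 < c) (x : E N) :
    truncatedLog Ω c C κ x ≤ c * Real.log (1 + κ) :=
  mul_le_mul_of_nonneg_left (min_le_right _ _) hc.le

theorem truncatedLog_eq_zero {N : ℕ} {Ω : Set (E N)} {c C κ : ℝ} (hκ : 0 < κ) {x : E N}
    (hx : x ∈ frontier Ω) : truncatedLog Ω c C κ x = 0 := by
  rw [truncatedLog, Metric.infDist_zero_of_mem hx, mul_zero, add_zero, Real.log_one,
    min_eq_left (Real.log_nonneg (by linarith)), mul_zero]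

theorem truncatedLog_of_le {N : ℕ} {Ω : Set (E N)} {c C κ : ℝ} (hκ : 0 < κ) {x : E N}
    (hx : κ ≤ C * Metric.infDist x (frontier Ω)) :
    truncatedLog Ω c C κ x = c * Real.log (1 + κ) := by
  rw [truncatedLog, min_eq_right (Real.log_le_log (by linarith) (by linarith))]

theorem truncatedLog_of_lt {N : ℕ} {Ω : Set (E N)} {c C κ : ℝ} (hC : 0 < C) {x : E N}
    (hx : C * Metric.infDist x (frontier Ω) < κ) :
    truncatedLog Ω c C κ x = c * Real.log (1 + C * Metric.infDist x (frontier Ω)) := by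
  have : 0 ≤ C * Metric.infDist x (frontier Ω) := mul_nonneg hC.le Metric.infDist_nonneg
  rw [truncatedLog, min_eq_left (Real.log_le_log (by linarith) (by linarith))]

theorem hasDerivAt_log_quadratic {c C d m R t : ℝ}
    (h : 0 < 1 + C * (d + t * m + t ^ 2 / (2 * R))) :
    HasDerivAt (fun t : ℝ => c * Real.log (1 + C * (d + t * m + t ^ 2 / (2 * R))))
      (c * (C * (m + t / R) / (1 + C * (d + t * m + t ^ 2 / (2 * R))))) t := by
  have h1 : HasDerivAt (fun t : ℝ => 1 + C * (d + t * m + t ^ 2 / (2 * R)))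
      (C * (m + t / R)) t := by
    refine HasDerivAt.congr_deriv
      ((((((hasDerivAt_id t).mul_const m).const_add d).add
        ((hasDerivAt_pow 2 t).div_const (2 * R))).const_mul C).const_add 1) ?_
    simp only [Nat.cast_ofNat, Nat.add_one_sub_one, pow_one, one_mul]
    rw [mul_div_mul_left _ _ two_ne_zero]
  exact (h1.log h.ne').const_mul c

/-- With g = C/(1+Cd), the concavity of the logarithm produces -g²m², the term that drives the
barrier. -/
theorem hasDerivAt_deriv_log_quadratic {c C d m R : ℝ} (h : 0 < 1 + C * d) :
    HasDerivAt (fun t : ℝ => c * (C * (m + t / R) / (1 + C * (d + t * m + t ^ 2 / (2 * R)))))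
      (c * ((C / (1 + C * d)) / R - (C / (1 + C * d)) ^ 2 * m ^ 2)) 0 := by
  have h1 : HasDerivAt (fun t : ℝ => 1 + C * (d + t * m + t ^ 2 / (2 * R))) (C * m) 0 := by
    refine HasDerivAt.congr_deriv
      ((((((hasDerivAt_id (0 : ℝ)).mul_const m).const_add d).add
        ((hasDerivAt_pow 2 (0 : ℝ)).div_const (2 * R))).const_mul C).const_add 1) ?_
    simp
  have h2 : HasDerivAt (fun t : ℝ => C * (m + t / R)) (C * (1 / R)) 0 :=
    (((hasDerivAt_id (0 : ℝ)).div_const R).const_add m).const_mul C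
  have h0 : (1 + C * (d + 0 * m + 0 ^ 2 / (2 * R))) ≠ 0 := by simpa using h.ne'
  refine ((h2.div h1 h0).const_mul c).congr_deriv ?_
  have h' := h.ne'
  simp only [zero_mul, add_zero, ne_eq, OfNat.ofNat_ne_zero, not_false_eq_true, zero_pow, zero_div]
  field_simp

/-- First and second order information on a test function touching the truncated logarithm of the
distance from below at a point where the truncation is inactive. -/
theorem testFunction_truncatedLog {N : ℕ} {Ω : Set (E N)} (hΩ : IsOpen Ω) {c C κ R : ℝ}
    (hc : 0 < c) (hC : 0 < C) {x n : E N} (hx : x ∈ Ω)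
    (hd : ∀ h : E N, x + h ∈ Ω → Metric.infDist (x + h) (frontier Ω) ≤
        Metric.infDist x (frontier Ω) + ⟪n, h⟫ + ‖h‖ ^ 2 / (2 * R))
    (hlt : C * Metric.infDist x (frontier Ω) < κ)
    {φ : E N → ℝ} (hφ : ContDiffAt ℝ 2 φ x)
    (hmin : IsLocalMin (fun y => truncatedLog Ω c C κ y - φ y) x) {v : E N} (hv : ‖v‖ = 1) :
    fderiv ℝ φ x v = c * (C / (1 + C * Metric.infDist x (frontier Ω))) * ⟪n, v⟫ ∧
    fderiv ℝ (fderiv ℝ φ) x v v ≤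
      c * ((C / (1 + C * Metric.infDist x (frontier Ω))) / R -
        (C / (1 + C * Metric.infDist x (frontier Ω))) ^ 2 * ⟪n, v⟫ ^ 2) := by
  have hTx := truncatedLog_of_lt (c := c) hC hlt
  set d := Metric.infDist x (frontier Ω) with hddef
  have hd0 : 0 ≤ d := Metric.infDist_nonneg
  have hpos : 0 < 1 + C * d := by positivity
  have hpos' : ∀ᶠ t : ℝ in 𝓝 0, 0 < 1 + C * (d + t * ⟪n, v⟫ + t ^ 2 / (2 * R)) := by
    have : ContinuousAt (fun t : ℝ => 1 + C * (d + t * ⟪n, v⟫ + t ^ 2 / (2 * R))) 0 := by fun_prop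
    exact this.eventually (lt_mem_nhds (by simpa using hpos))
  have htend : Tendsto (fun t : ℝ => x + t • v) (𝓝 0) (𝓝 x) := by
    have : ContinuousAt (fun t : ℝ => x + t • v) 0 := by fun_prop
    simpa using this.tendsto
  have key := fderiv_eq_and_le_of_touching (v := v) hφ
    (Q := fun t => c * Real.log (1 + C * (d + t * ⟪n, v⟫ + t ^ 2 / (2 * R))))
    (hpos'.mono fun t ht => hasDerivAt_log_quadratic ht)
    (hasDerivAt_deriv_log_quadratic hpos) ?_
  · refine ⟨?_, key.2⟩
    rw [key.1]
    simp
    ring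
  · filter_upwards [htend.eventually hmin, htend.eventually (hΩ.mem_nhds hx)] with t h1 h2
    have h3 := hd (t • v) h2
    rw [inner_smul_right, norm_smul, hv, mul_one, Real.norm_eq_abs, sq_abs] at h3
    have h4 : 0 ≤ Metric.infDist (x + t • v) (frontier Ω) := Metric.infDist_nonneg
    have h5 : truncatedLog Ω c C κ (x + t • v) ≤
        c * Real.log (1 + C * (d + t * ⟪n, v⟫ + t ^ 2 / (2 * R))) := by
      refine mul_le_mul_of_nonneg_left ((min_le_left _ _).trans ?_) hc.le
      refine Real.log_le_log (by positivity) ?_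
      have := mul_le_mul_of_nonneg_left h3 hC.le
      linarith
    rw [hTx] at h1
    simp only [zero_mul, add_zero, ne_eq, OfNat.ofNat_ne_zero, not_false_eq_true, zero_pow,
      zero_div]
    linarith

/-- The truncated logarithm is not locally constant where the truncation is inactive. -/
theorem not_locallyConstantAt_truncatedLog {N : ℕ} {Ω : Set (E N)} (hΩ : IsOpen Ω)
    {c C κ R : ℝ} (hc : 0 < c) (hC : 0 < C) (hR : 0 < R) {x n : E N} (hx : x ∈ Ω) (hn : ‖n‖ = 1)
    (hd : ∀ h : E N, x + h ∈ Ω → Metric.infDist (x + h) (frontier Ω) ≤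
        Metric.infDist x (frontier Ω) + ⟪n, h⟫ + ‖h‖ ^ 2 / (2 * R))
    (hlt : C * Metric.infDist x (frontier Ω) < κ) :
    ¬ LocallyConstantAt (truncatedLog Ω c C κ) x := by
  intro hconst
  have htend : Tendsto (fun t : ℝ => x + t • n) (𝓝 0) (𝓝 x) := by
    have : ContinuousAt (fun t : ℝ => x + t • n) 0 := by fun_prop
    simpa using this.tendsto
  -- Moving by t n with -2R < t < 0 strictly decreases the distance, since t + t²/(2R) < 0.
  have hev : ∀ᶠ t : ℝ in 𝓝[<] 0, truncatedLog Ω c C κ (x + t • n) = truncatedLog Ω c C κ x ∧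
      x + t • n ∈ Ω ∧ -(2 * R) < t :=
    ((htend.eventually hconst).and ((htend.eventually (hΩ.mem_nhds hx)).and
      (lt_mem_nhds (by linarith)))).filter_mono nhdsWithin_le_nhds
  obtain ⟨t, ⟨h1, h2, h3⟩, h4⟩ := (hev.and self_mem_nhdsWithin).exists
  have h4 : t < 0 := h4
  have h5 := hd (t • n) h2
  rw [inner_smul_right, norm_smul, hn, real_inner_self_eq_norm_sq, hn, mul_one, Real.norm_eq_abs,
    sq_abs, one_pow, mul_one] at h5
  have h6 : t + t ^ 2 / (2 * R) < 0 := by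
    have : t + t ^ 2 / (2 * R) = t * (t + 2 * R) / (2 * R) := by
      field_simp
      ring
    rw [this]
    exact div_neg_of_neg_of_pos (mul_neg_of_neg_of_pos h4 (by linarith)) (by linarith)
  have h7 : Metric.infDist (x + t • n) (frontier Ω) < Metric.infDist x (frontier Ω) := by linarith
  have h8 : C * Metric.infDist (x + t • n) (frontier Ω) < C * Metric.infDist x (frontier Ω) :=
    mul_lt_mul_of_pos_left h7 hC
  have h9 : 0 ≤ C * Metric.infDist (x + t • n) (frontier Ω) :=
    mul_nonneg hC.le Metric.infDist_nonneg
  rw [truncatedLog_of_lt hC hlt, truncatedLog_of_lt hC (h8.trans hlt)] at h1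
  have := mul_lt_mul_of_pos_left (Real.log_lt_log (by linarith)
    (by linarith : 1 + C * Metric.infDist (x + t • n) (frontier Ω) <
      1 + C * Metric.infDist x (frontier Ω))) hc
  linarith

/-- The gradient and Hessian of a test function touching the truncated logarithm from below with
nonvanishing gradient. -/
theorem gradient_testFunction_truncatedLog {N : ℕ} {Ω : Set (E N)} (hΩ : IsOpen Ω)
    {c C κ R : ℝ} (hc : 0 < c) (hC : 0 < C) (hκ : 0 < κ) {x n : E N} (hx : x ∈ Ω) (hn : ‖n‖ = 1)
    (hd : ∀ h : E N, x + h ∈ Ω → Metric.infDist (x + h) (frontier Ω) ≤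
        Metric.infDist x (frontier Ω) + ⟪n, h⟫ + ‖h‖ ^ 2 / (2 * R))
    {φ : E N → ℝ} (hφ : ContDiffAt ℝ 2 φ x)
    (hmin : IsLocalMin (fun y => truncatedLog Ω c C κ y - φ y) x) (hgrad : gradient φ x ≠ 0) :
    ∃ g, C / (1 + κ) ≤ g ∧ ‖gradient φ x‖ = c * g ∧ ∀ v : E N, ‖v‖ = 1 →
      fderiv ℝ (fderiv ℝ φ) x v v ≤ c * (g / R) - c * g ^ 2 * ⟪n, v⟫ ^ 2 := by
  -- On the plateau the barrier attains its maximum, so φ has a local maximum there and its gradient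
  -- vanishes.
  have hlt : C * Metric.infDist x (frontier Ω) < κ := by
    by_contra hge
    refine hgrad ?_
    have hmax : IsLocalMax φ x := by
      filter_upwards [hmin] with y hy
      rw [truncatedLog_of_le hκ (not_lt.1 hge)] at hy
      linarith [truncatedLog_le Ω (C := C) (κ := κ) hc y]
    rw [gradient, hmax.fderiv_eq_zero, map_zero]
  have hd0 : 0 ≤ Metric.infDist x (frontier Ω) := Metric.infDist_nonneg
  have hpos : 0 < 1 + C * Metric.infDist x (frontier Ω) := by positivity
  refine ⟨C / (1 + C * Metric.infDist x (frontier Ω)), ?_, ?_, fun v hv => ?_⟩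
  · exact div_le_div_of_nonneg_left hC.le hpos (by linarith)
  · set g := C / (1 + C * Metric.infDist x (frontier Ω)) with hg
    have hg0 : 0 < g := by positivity
    have hgn : gradient φ x = (c * g) • n := by
      refine ext_inner_right ℝ fun v => ?_
      rw [gradient, InnerProductSpace.toDual_symm_apply, inner_smul_left]
      rcases eq_or_ne v 0 with rfl | hv
      · simp
      have hv' : ‖v‖ ≠ 0 := norm_ne_zero_iff.2 hv
      have h1 := (testFunction_truncatedLog hΩ hc hC hx hd hlt hφ hmin
        (v := ‖v‖⁻¹ • v) (by rw [norm_smul, norm_inv, norm_norm, inv_mul_cancel₀ hv'])).1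
      rw [map_smul, inner_smul_right, smul_eq_mul, ← hg] at h1
      have h2 : ‖v‖⁻¹ * fderiv ℝ φ x v = ‖v‖⁻¹ * (c * g * ⟪n, v⟫) := by rw [h1]; ring
      simpa using mul_left_cancel₀ (inv_ne_zero hv') h2
    rw [hgn, norm_smul, hn, mul_one, Real.norm_of_nonneg (by positivity)]
  · refine ((testFunction_truncatedLog hΩ hc hC hx hd hlt hφ hmin hv).2).trans (le_of_eq ?_)
    ring

/-! ### Choice of the constants -/

/-- Half of the leading term absorbs the gradient term: by its higher order in g if β < α+2, and by
the choice c = a/(2b), with equality, if β = α+2. -/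
theorem exists_eventually_rpow_le {a α β b : ℝ} (ha : 0 < a) (hβα : β ≤ α + 2) (hb : 0 < b) :
    ∃ c > 0, (β < α + 2 → c = 1) ∧
      ∀ᶠ g : ℝ in atTop, b * (c * g) ^ β ≤ a / 2 * (c ^ (α + 1) * g ^ (α + 2)) := by
  rcases hβα.lt_or_eq with hlt | heq
  · refine ⟨1, one_pos, fun _ => rfl, ?_⟩
    have hlim := tendsto_rpow_neg_atTop (y := α + 2 - β) (by linarith)
    filter_upwards [hlim.eventually (gt_mem_nhds (by positivity : 0 < a / (2 * b))),
      eventually_gt_atTop 0] with g h1 hg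
    rw [one_mul, Real.one_rpow, one_mul]
    have h2 : g ^ β = g ^ (-(α + 2 - β)) * g ^ (α + 2) := by
      rw [← Real.rpow_add hg]
      congr 1
      ring
    have h3 : b * g ^ (-(α + 2 - β)) ≤ a / 2 := by
      calc b * g ^ (-(α + 2 - β)) ≤ b * (a / (2 * b)) := mul_le_mul_of_nonneg_left h1.le hb.le
        _ = a / 2 := by field_simp
    rw [h2, ← mul_assoc]
    exact mul_le_mul_of_nonneg_right h3 (Real.rpow_nonneg hg.le _)
  · have hc : 0 < a / (2 * b) := by positivity
    refine ⟨a / (2 * b), hc, fun h => absurd heq h.ne, ?_⟩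
    filter_upwards [eventually_gt_atTop 0] with g hg
    refine le_of_eq ?_
    have h1 : (a / (2 * b)) ^ (α + 2) = (a / (2 * b)) ^ (α + 1) * (a / (2 * b)) := by
      rw [← Real.rpow_add_one hc.ne']
      congr 1
      ring
    rw [heq, Real.mul_rpow hc.le hg.le, h1]
    field_simp

theorem exists_barrier_constants {a K α β b R : ℝ} (ha : 0 < a) (hα : -1 < α)
    (hβα : β ≤ α + 2) (hb : 0 < b) (hR : 0 < R) (M : ℝ) :
    ∃ c > 0, (β < α + 2 → c = 1) ∧ ∃ G > 0, ∀ g ≥ G,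
      (c * g) ^ α * (K * (c * (g / R)) - a * (c * g ^ 2)) + b * (c * g) ^ β ≤ -M := by
  obtain ⟨c, hc, hc1, hev⟩ := exists_eventually_rpow_le ha hβα hb
  refine ⟨c, hc, hc1, ?_⟩
  have hcα : 0 < c ^ (α + 1) := Real.rpow_pos_of_pos hc _
  have hall : ∀ᶠ g : ℝ in atTop,
      (c * g) ^ α * (K * (c * (g / R)) - a * (c * g ^ 2)) + b * (c * g) ^ β ≤ -M := by
    -- The curvature term takes a/4 of the coefficient a and the gradient term a/2; the last
    -- threshold makes the remaining a/4 yield M.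
    filter_upwards [hev, eventually_gt_atTop 0, eventually_ge_atTop (4 * K / (R * a)),
      (tendsto_rpow_atTop (by linarith : 0 < α + 2)).eventually_ge_atTop
        (4 * M / (a * c ^ (α + 1)))] with g h1 hg h2 h3
    rw [div_le_iff₀ (by positivity)] at h2 h3
    have hgα : 0 < g ^ (α + 2) := Real.rpow_pos_of_pos hg _
    have h4 : (c * g) ^ α * (K * (c * (g / R)) - a * (c * g ^ 2)) =
        c ^ (α + 1) * g ^ (α + 2) * (K / (R * g) - a) := by
      rw [Real.mul_rpow hc.le hg.le, Real.rpow_add hc, Real.rpow_add hg, Real.rpow_one,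
        Real.rpow_two]
      field_simp
    have h5 : K / (R * g) ≤ a / 4 := by
      rw [div_le_iff₀ (by positivity)]
      linarith
    have h6 : c ^ (α + 1) * g ^ (α + 2) * (K / (R * g) - a) ≤
        c ^ (α + 1) * g ^ (α + 2) * (a / 4 - a) :=
      mul_le_mul_of_nonneg_left (by linarith) (by positivity)
    rw [h4]
    linarith
  obtain ⟨G, hG⟩ := eventually_atTop.1 hall
  exact ⟨max G 1, by positivity, fun g hg => hG g ((le_max_left _ _).trans hg)⟩

/-- The constants of the truncated logarithmic barrier, with the properties that make it a
supersolution and its negative a subsolution. -/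
theorem exists_truncatedLog_barrier {N : ℕ} (hN : 1 ≤ N) {Ω : Set (E N)}
    (hΩ : IsC2Open Ω) (hΩb : Bornology.IsBounded Ω) {a A α β lam b M : ℝ} (ha : 0 < a)
    (hα : -1 < α) (hβα : β ≤ α + 2) (hlam : 0 < lam) (hb : 0 < b) (hM : 0 < M) :
    ∃ c C κ : ℝ, 0 < c ∧ 0 < C ∧ 0 < κ ∧ (β < α + 2 → c = 1) ∧ ∀ x ∈ Ω,
      (LocallyConstantAt (truncatedLog Ω c C κ) x →
        M ≤ lam * truncatedLog Ω c C κ x ^ (1 + α)) ∧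
      ∀ φ : E N → ℝ, ContDiffAt ℝ 2 φ x →
        IsLocalMin (fun y => truncatedLog Ω c C κ y - φ y) x → gradient φ x ≠ 0 →
        ∃ (n : E N) (s t : ℝ), ‖n‖ = 1 ∧ 0 ≤ s ∧ 0 ≤ t ∧
          (∀ v : E N, ‖v‖ = 1 →
            fderiv ℝ (fderiv ℝ φ) x v v ≤ s - t * inner ℝ n v ^ 2) ∧
          ‖gradient φ x‖ ^ α * (A * N * s - a * t) + b * ‖gradient φ x‖ ^ β ≤ -M := by
  obtain ⟨R, hR, hdist⟩ := exists_infDist_frontier_le hN hΩ hΩb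
  obtain ⟨c, hc, hc1, G, hG, hgM⟩ :=
    exists_barrier_constants (K := A * N) ha hα hβα hb hR M
  -- The plateau height T = (M/λ)^(1/(1+α)) solves λ T^(1+α) = M, and κ is then fixed by c log(1+κ)
  -- = T.
  have hT : 0 < (M / lam) ^ (1 + α)⁻¹ := by positivity
  have hκ : 0 < Real.exp ((M / lam) ^ (1 + α)⁻¹ / c) - 1 :=
    sub_pos.2 (Real.one_lt_exp_iff.2 (by positivity))
  set κ := Real.exp ((M / lam) ^ (1 + α)⁻¹ / c) - 1 with hκdef
  have hlog : c * Real.log (1 + κ) = (M / lam) ^ (1 + α)⁻¹ := by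
    rw [hκdef, add_sub_cancel, Real.log_exp]
    field_simp
  -- With C = G(1+κ), the lower bound C/(1+κ) for g is exactly G.
  have hC : 0 < G * (1 + κ) := by positivity
  refine ⟨c, G * (1 + κ), κ, hc, hC, hκ, hc1, fun x hx => ?_⟩
  obtain ⟨n, hn, hd⟩ := hdist x hx
  refine ⟨fun hconst => ?_, fun φ hφ hmin hgrad => ?_⟩
  · rcases lt_or_ge (G * (1 + κ) * Metric.infDist x (frontier Ω)) κ with hlt | hge
    · exact absurd hconst (not_locallyConstantAt_truncatedLog hΩ.1 hc hC hR hx hn hd hlt)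
    · rw [truncatedLog_of_le hκ hge, hlog,
        Real.rpow_inv_rpow (by positivity) (by linarith : 1 + α ≠ 0)]
      field_simp
      exact le_rfl
  · obtain ⟨g, hg, hnorm, hsnd⟩ :=
      gradient_testFunction_truncatedLog hΩ.1 hc hC hκ hx hn hd hφ hmin hgrad
    rw [mul_div_cancel_right₀ _ (by positivity)] at hg
    have hg0 : 0 < g := hG.trans_le hg
    refine ⟨n, c * (g / R), c * g ^ 2, hn, by positivity, by positivity, hsnd, ?_⟩
    rw [hnorm]
    exact hgM g hg

/-- Only 1 + α ≠ 0 is needed to add exponents, so s = 0 is covered even when α ≤ 0. -/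
theorem abs_neg_rpow_mul_neg {s α : ℝ} (hs : 0 ≤ s) (hα : -1 < α) :
    |-s| ^ α * -s = -s ^ (1 + α) := by
  rw [abs_neg, abs_of_nonneg hs, mul_neg, add_comm, Real.rpow_add_one' hs (by linarith)]

end PucciBarrier

end

/-! ### The two barriers -/

theorem mainTheorem6 (N : ℕ) (hN : 1 ≤ N) (Ω : Set (PucciBarrier.E N))
    (hΩ : PucciBarrier.IsC2Open Ω) (hΩb : Bornology.IsBounded Ω)
    (a A : ℝ) (ha : 0 < a) (haA : a ≤ A)
    (α β : ℝ) (hα : -1 < α) (hβ : 0 < β) (hβα : β ≤ α + 2)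
    (lam b : ℝ) (hlam : 0 < lam) (hb : 0 < b) (M : ℝ) (hM : 0 < M) :
    (∃ φ : PucciBarrier.E N → ℝ,
      ContinuousOn φ (closure Ω) ∧ (∀ x ∈ closure Ω, 0 ≤ φ x) ∧ (∀ x ∈ frontier Ω, φ x = 0) ∧
      PucciBarrier.IsViscositySupersolution
        (fun p X => ‖p‖ ^ α * PucciBarrier.pucciPlus a A X) (fun _ => -b) β
        (fun _ s => M - lam * s ^ (1 + α)) Ω φ ∧
      ∃ c C κ : ℝ, 0 < c ∧ 0 < C ∧ 0 < κ ∧ (β < α + 2 → c = 1) ∧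
        ∀ x ∈ closure Ω, φ x = PucciBarrier.truncatedLog Ω c C κ x) ∧
    (∃ φ : PucciBarrier.E N → ℝ,
      ContinuousOn φ (closure Ω) ∧ (∀ x ∈ closure Ω, φ x ≤ 0) ∧ (∀ x ∈ frontier Ω, φ x = 0) ∧
      PucciBarrier.IsViscositySubsolution
        (fun p X => ‖p‖ ^ α * PucciBarrier.pucciMinus a A X) (fun _ => b) β
        (fun _ s => -M - lam * (|s| ^ α * s)) Ω φ ∧
      ∃ c C κ : ℝ, 0 < c ∧ 0 < C ∧ 0 < κ ∧ (β < α + 2 → c = 1) ∧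
        ∀ x ∈ closure Ω, φ x = -PucciBarrier.truncatedLog Ω c C κ x) := by
  obtain ⟨c, C, κ, hc, hC, hκ, hc1, hbar⟩ := PucciBarrier.exists_truncatedLog_barrier (A := A)
    hN hΩ hΩb ha hα hβα hlam hb hM
  have hcont := PucciBarrier.continuous_truncatedLog Ω (c := c) (κ := κ) hC
  have hnn := PucciBarrier.truncatedLog_nonneg Ω hc hC hκ
  refine ⟨⟨PucciBarrier.truncatedLog Ω c C κ, hcont.continuousOn, fun x _ => hnn x,
    fun x hx => PucciBarrier.truncatedLog_eq_zero hκ hx,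
    ⟨hcont.lowerSemicontinuous.lowerSemicontinuousOn _, fun x hx =>
      ⟨fun hlc => ?_, fun _ φ hφ hmin hgrad => ?_⟩⟩,
    c, C, κ, hc, hC, hκ, hc1, fun x _ => rfl⟩,
    ⟨fun x => -PucciBarrier.truncatedLog Ω c C κ x, hcont.neg.continuousOn,
    fun x _ => neg_nonpos.2 (hnn x),
    fun x hx => neg_eq_zero.2 (PucciBarrier.truncatedLog_eq_zero hκ hx),
    ⟨hcont.neg.upperSemicontinuous.upperSemicontinuousOn _, fun x hx =>
      ⟨fun hlc => ?_, fun _ φ hφ hmax hgrad => ?_⟩⟩,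
    c, C, κ, hc, hC, hκ, hc1, fun x _ => rfl⟩⟩
  · linarith [(hbar x hx).1 hlc]
  · obtain ⟨n, s, t, hn, hs, ht, hsnd, hle⟩ := (hbar x hx).2 φ hφ hmin hgrad
    have hP := PucciBarrier.pucciPlus_le ha haA hs ht (PucciBarrier.hessian φ x hφ) hn
      fun v hv => (PucciBarrier.dotProduct_hessianMatrix_mulVec φ x v).trans_le (hsnd v hv)
    have h1 := mul_le_mul_of_nonneg_left hP (Real.rpow_nonneg (norm_nonneg (gradient φ x)) α)
    -- Where the gradient is nonzero, the zero-order term has the favourable sign and is dropped.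
    have h2 : 0 ≤ lam * PucciBarrier.truncatedLog Ω c C κ x ^ (1 + α) :=
      mul_nonneg hlam.le (Real.rpow_nonneg (hnn x) _)
    linarith
  · have h1 := (hbar x hx).1 (hlc.mono fun y hy => neg_injective hy)
    have h2 := PucciBarrier.abs_neg_rpow_mul_neg (hnn x) hα
    dsimp only at h2 ⊢
    rw [h2]
    linarith
  -- A test function φ touching the negated barrier from above becomes -φ touching the barrier from
  -- below.
  · have hneg : gradient (-φ) x = -gradient φ x := by
      rw [gradient, fderiv_neg, map_neg, gradient]
    have hsec : fderiv ℝ (fderiv ℝ (-φ)) x = -fderiv ℝ (fderiv ℝ φ) x := by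
      have : fderiv ℝ (-φ) = -fderiv ℝ φ := by
        ext1 y
        rw [fderiv_neg, Pi.neg_apply]
      rw [this, fderiv_neg]
    have hmin : IsLocalMin (fun y => PucciBarrier.truncatedLog Ω c C κ y - (-φ) y) x := by
      filter_upwards [hmax] with y hy
      simp only [Pi.neg_apply]
      linarith
    obtain ⟨n, s, t, hn, hs, ht, hsnd, hle⟩ := (hbar x hx).2 (-φ) hφ.neg hmin
      (by rw [hneg]; exact neg_ne_zero.2 hgrad)
    rw [hneg, norm_neg] at hle
    have hP := PucciBarrier.le_pucciMinus ha haA hs ht (PucciBarrier.hessian φ x hφ) hn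
      fun v hv => by
        have h1 := hsnd v hv
        rw [hsec, neg_apply, neg_apply] at h1
        have h2 := PucciBarrier.dotProduct_hessianMatrix_mulVec φ x v
        simp only [PucciBarrier.hessian]
        linarith
    have h1 := mul_le_mul_of_nonneg_left hP (Real.rpow_nonneg (norm_nonneg (gradient φ x)) α)
    have h2 : 0 ≤ lam * PucciBarrier.truncatedLog Ω c C κ x ^ (1 + α) :=
      mul_nonneg hlam.le (Real.rpow_nonneg (hnn x) _)
    have h3 := PucciBarrier.abs_neg_rpow_mul_neg (hnn x) hα
    dsimp only at h3 ⊢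
    rw [h3]
    linarith
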